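/- Let $\Gamma=(V,E)$ be a finite simple graph and let $\mathcal{A}=\{(x,y),(y,x) : \{x,y\}\in E\}$ be its set of symmetric arcs. An arc $a=(x,y)$ has origin $o(a)=x$, terminus $t(a)=y$ and inverse $a^{-1}=(y,x)$. Define matrices $d\in\mathbb{C}^{V\times\mathcal{A}}$ and $R\in\mathbb{C}^{\mathcal{A}\times\mathcal{A}}$ by $d_{x,a}=\frac{1}{\sqrt{\deg x}}\,\delta_{x,t(a)}$ and $R_{a,b}=\delta_{a,b^{-1}}$. The Grover walk on $\Gamma$ is the quantum walk with time evolution matrix $U=R(2d^*d-I)$. A state is a vector in $\mathbb{C}^{\mathcal{A}}$ of Euclidean norm $1$; it is of vertex type if it equals $d^*e_x$ for some $x\in V$, where $e_x\in\mathbb{C}^V$ is the standard unit vector at $x$. The graph $\Gamma$ admits perfect state transfer if there are two distinct vertex type states $\Phi,\Psi$, an integer $\tau\ge 1$ and $\gamma\in\mathbb{C}$ with $|\gamma|=1$ such that $U^{\tau}\Phi=\gamma\Psi$. The graph $\Gamma$ is strongly regular if it is neither complete nor edgeless and there are integers $k,\lambda,\mu \ge 0$ such that every vertex has exactly $k$ neighbours,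 any two adjacent vertices have exactly $\lambda$ common neighbours, and any two distinct non-adjacent vertices have exactly $\mu$ common neighbours. **Theorem.** A connected strongly regular graph $\Gamma$ admits perfect state transfer if and only if it is isomorphic to the complete bipartite graph $K_{2,2}$ or to the complete tripartite graph $K_{2,2,2}$. -/

import Mathlib

open scoped Matrix

namespace GroverWalk

variable {V : Type*} [Fintype V] [DecidableEq V] (G : SimpleGraph V) [DecidableRel G.Adj]

/-- The boundary matrix `d`, with `d x a = δ_{x, t(a)} / √(deg x)`. The symmetric arcs of `G` are
its darts; the origin of `a` is `a.fst`, its terminus is `a.snd`, its inverse is `a.symm`. -/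
noncomputable def boundary : Matrix V G.Dart ℂ :=
  Matrix.of fun x a => if x = a.snd then 1 / ((Real.sqrt (G.degree x : ℝ) : ℝ) : ℂ) else 0

/-- The shift matrix `R`, with `R a b = δ_{a, b⁻¹}`. -/
def shift : Matrix G.Dart G.Dart ℂ :=
  Matrix.of fun a b => if a = b.symm then 1 else 0

/-- The time evolution matrix `U = R (2 d* d - I)` of the Grover walk on `G`. -/
noncomputable def timeEvolution : Matrix G.Dart G.Dart ℂ :=
  shift G * ((2 : ℂ) • ((boundary G)ᴴ * boundary G) - 1)

variable {G}

/-- A state is a vector of Euclidean norm one in the space of complex functions on the arcs. -/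
def IsState (Φ : G.Dart → ℂ) : Prop :=
  ‖WithLp.toLp 2 Φ‖ = 1

/-- A vertex type state is a state of the form `d* e_x` for a vertex `x`. -/
def IsVertexType (Φ : G.Dart → ℂ) : Prop :=
  IsState Φ ∧ ∃ x : V, Φ = (boundary G)ᴴ *ᵥ Pi.single x 1

/-- Perfect state transfer occurs from the state `Φ` to the distinct state `Ψ` at the time
`τ ≥ 1`: one has `U ^ τ Φ = γ Ψ` for some complex number `γ` of norm one. -/
def PSTOccurs (Φ Ψ : G.Dart → ℂ) (τ : ℕ) : Prop :=
  IsState Φ ∧ IsState Ψ ∧ Φ ≠ Ψ ∧ 1 ≤ τ ∧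
    ∃ γ : ℂ, ‖γ‖ = 1 ∧ (timeEvolution G ^ τ) *ᵥ Φ = γ • Ψ

variable (G)

/-- `G` admits perfect state transfer: it occurs between two distinct vertex type states,
at some time. -/
def AdmitsPST : Prop :=
  ∃ Φ Ψ : G.Dart → ℂ, IsVertexType Φ ∧ IsVertexType Ψ ∧ Φ ≠ Ψ ∧ ∃ τ : ℕ, PSTOccurs Φ Ψ τ

/-- `G` is strongly regular, with some parameters: it is neither complete nor edgeless, it is
regular, and the number of common neighbours of two distinct vertices depends only on
whether they are adjacent. -/
def IsStronglyRegular : Prop :=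
  G ≠ ⊤ ∧ G ≠ ⊥ ∧ ∃ n k l m : ℕ, G.IsSRGWith n k l m

end GroverWalk

open scoped Matrix
open Polynomial.Chebyshev

namespace GroverWalk

/-! ### Compression of the walk and the Chebyshev recurrence -/

section Walk
variable {V : Type*} [Fintype V] [DecidableEq V] (G : SimpleGraph V) [DecidableRel G.Adj]

/-! Write `C n = d Uⁿ d*` (`compression`). Since `d d* = 1` and `R² = 1`, these matrices satisfy the
Chebyshev recurrence (`compression_add_two`), so `C n = Tₙ(C 1)`, where `C 1 = A / k` on a
`k`-regular graph. Perfect state transfer from `x` to `y` gives `C n e_x = γ e_y`; conversely `C n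
e_x = e_y` suffices because `U` is unitary. On a strongly regular graph `C n` lies in the span of
`1`, `A` and the adjacency matrix of the complement, so column `x` is constant on neighbours and on
non-neighbours of `x`. If it vanishes off `x` except at `y`, then `y` is the only neighbour, which
forces the excluded `K₂`, or the only non-neighbour, which makes `G` a cocktail party graph
(`exists_isCocktailParty_of_compression`). There `A / k` has eigenvalues `1`, `0`, `-2/k`, and
transfer forces `Tₙ(-2/k) = 1`. Hence `arccos (-2/k)` is a rational multiple of `π`, and Niven's
theorem leaves `k = 2` and `k = 4`. Times `2` and `6` realise these cases. -/

theorem card_darts_snd (x : V) :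
    (Finset.univ.filter fun a : G.Dart => a.snd = x).card = G.degree x := by
  rw [← G.dart_fst_fiber_card_eq_degree x]
  refine Finset.card_bij (fun a _ => a.symm) ?_ ?_ ?_
  · intro a ha
    simpa using ha
  · intro a _ b _ h
    exact SimpleGraph.Dart.symm_involutive.injective h
  · intro b hb
    exact ⟨b.symm, by simpa using hb, b.symm_symm⟩

theorem boundary_conjTranspose_apply (a : G.Dart) (x : V) :
    (boundary G)ᴴ a x =
      if x = a.snd then 1 / ((Real.sqrt (G.degree x : ℝ) : ℝ) : ℂ) else 0 := by
  simp only [boundary, Matrix.conjTranspose_apply, Matrix.of_apply]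
  split_ifs <;> simp [Complex.conj_ofReal]

theorem boundary_apply (x : V) (a : G.Dart) :
    boundary G x a =
      if x = a.snd then 1 / ((Real.sqrt (G.degree x : ℝ) : ℝ) : ℂ) else 0 := rfl

theorem boundary_mul_conjTranspose (h : ∀ x, 0 < G.degree x) :
    boundary G * (boundary G)ᴴ = 1 := by
  ext x y
  rw [Matrix.mul_apply, Matrix.one_apply]
  simp only [boundary_conjTranspose_apply, boundary_apply]
  split_ifs with hxy
  · subst hxy
    have hs : ((Real.sqrt (G.degree x : ℝ) : ℝ) : ℂ) * ((Real.sqrt (G.degree x : ℝ) : ℝ) : ℂ)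
        = G.degree x := by
      rw [← Complex.ofReal_mul, Real.mul_self_sqrt (Nat.cast_nonneg _)]
      simp
    have hd : (G.degree x : ℂ) ≠ 0 := by exact_mod_cast (h x).ne'
    simp only [mul_ite, mul_zero, ite_mul, zero_mul, ← ite_and, and_self]
    rw [← Finset.sum_filter, Finset.sum_const]
    simp_rw [eq_comm (a := x), card_darts_snd]
    rw [div_mul_div_comm, hs, nsmul_eq_mul]
    field_simp
  · refine Finset.sum_eq_zero fun a _ => ?_
    split_ifs with h1 h2 <;> simp
    exact (hxy (h1.trans h2.symm)).elim

theorem shift_mul_apply {W : Type*} (M : Matrix G.Dart W ℂ) (a : G.Dart) (w : W) :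
    (shift G * M) a w = M a.symm w := by
  rw [Matrix.mul_apply, Finset.sum_eq_single a.symm]
  · simp [shift]
  · intro b _ hb
    have : a ≠ b.symm := fun h => hb (by rw [h, SimpleGraph.Dart.symm_symm])
    simp [shift, this]
  · simp

theorem shift_mul_shift : shift G * shift G = 1 := by
  ext a b
  rw [shift_mul_apply, Matrix.one_apply]
  simp [shift, SimpleGraph.Dart.symm_involutive.injective.eq_iff]

theorem shift_conjTranspose : (shift G)ᴴ = shift G := by
  ext a b
  have : b = a.symm ↔ a = b.symm :=
    ⟨fun h => by rw [h, SimpleGraph.Dart.symm_symm], fun h => by rw [h, SimpleGraph.Dart.symm_symm]⟩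
  simp only [shift, Matrix.conjTranspose_apply, Matrix.of_apply, this]
  split_ifs <;> simp

theorem timeEvolution_conjTranspose_mul_self (h : ∀ x, 0 < G.degree x) :
    (timeEvolution G)ᴴ * timeEvolution G = 1 := by
  have hd := boundary_mul_conjTranspose G h
  set D := boundary G
  have hDD : (Dᴴ * D) * (Dᴴ * D) = Dᴴ * D := by
    rw [Matrix.mul_assoc, ← Matrix.mul_assoc D, hd, Matrix.one_mul]
  have hstar : ((2 : ℂ) • (Dᴴ * D) - 1)ᴴ = (2 : ℂ) • (Dᴴ * D) - 1 := by
    rw [Matrix.conjTranspose_sub, Matrix.conjTranspose_smul, Matrix.conjTranspose_mul]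
    simp
  have hsq : ((2 : ℂ) • (Dᴴ * D) - 1) * ((2 : ℂ) • (Dᴴ * D) - 1) = 1 := by
    rw [Matrix.sub_mul, Matrix.mul_sub, Matrix.smul_mul, Matrix.mul_smul, hDD, Matrix.mul_one,
      Matrix.one_mul]
    module
  rw [timeEvolution, Matrix.conjTranspose_mul, hstar, shift_conjTranspose, Matrix.mul_assoc,
    ← Matrix.mul_assoc (shift G), shift_mul_shift, Matrix.one_mul, hsq]

theorem timeEvolution_pow_conjTranspose_mul_self (h : ∀ x, 0 < G.degree x) (n : ℕ) :
    (timeEvolution G ^ n)ᴴ * timeEvolution G ^ n = 1 := by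
  induction n with
  | zero => simp
  | succ n ih =>
    rw [pow_succ', Matrix.conjTranspose_mul, Matrix.mul_assoc,
      ← Matrix.mul_assoc (timeEvolution G)ᴴ, timeEvolution_conjTranspose_mul_self G h,
      Matrix.one_mul, ih]

/-- The compression of a power of the time evolution to the space of the vertex type states. -/
noncomputable def compression (n : ℕ) : Matrix V V ℂ :=
  boundary G * (timeEvolution G ^ n * (boundary G)ᴴ)

theorem compression_zero (h : ∀ x, 0 < G.degree x) : compression G 0 = 1 := by
  simp [compression, boundary_mul_conjTranspose G h]

theorem timeEvolution_mul_conjTranspose (h : ∀ x, 0 < G.degree x) :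
    timeEvolution G * (boundary G)ᴴ = shift G * (boundary G)ᴴ := by
  rw [timeEvolution, Matrix.mul_assoc, Matrix.sub_mul, Matrix.smul_mul, Matrix.mul_assoc,
    boundary_mul_conjTranspose G h, Matrix.mul_one, Matrix.one_mul]
  congr 1
  module

/-- As `U d* = R d*`, one has `U² d* = R (2 d* d - 1) R d*`, and `R² = 1` turns the last term into
`-d*`. Multiplying on the left by `d Uⁿ` then yields the Chebyshev recurrence. -/
theorem timeEvolution_sq_mul_conjTranspose (h : ∀ x, 0 < G.degree x) :
    timeEvolution G * (timeEvolution G * (boundary G)ᴴ) =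
      (2 : ℂ) • (timeEvolution G * (boundary G)ᴴ * compression G 1) - (boundary G)ᴴ := by
  rw [compression, pow_one, timeEvolution_mul_conjTranspose G h]
  conv_lhs => rw [timeEvolution, Matrix.mul_assoc, Matrix.sub_mul, Matrix.one_mul, Matrix.mul_sub,
    ← Matrix.mul_assoc (shift G) (shift G), shift_mul_shift, Matrix.one_mul]
  simp only [Matrix.smul_mul, Matrix.mul_smul, Matrix.mul_assoc]

theorem compression_add_two (h : ∀ x, 0 < G.degree x) (n : ℕ) :
    compression G (n + 2) = (2 : ℂ) • (compression G (n + 1) * compression G 1)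
      - compression G n := by
  conv_lhs => rw [compression, pow_add, pow_two, Matrix.mul_assoc (timeEvolution G ^ n),
    Matrix.mul_assoc (timeEvolution G), timeEvolution_sq_mul_conjTranspose G h, Matrix.mul_sub,
    Matrix.mul_sub, Matrix.mul_smul, Matrix.mul_smul]
  rw [← Matrix.mul_assoc (timeEvolution G ^ n), ← Matrix.mul_assoc (timeEvolution G ^ n),
    ← pow_succ, ← Matrix.mul_assoc (boundary G)]
  rfl

theorem compression_one {k : ℕ} (hG : G.IsRegularOfDegree k) (hk : 0 < k) :
    compression G 1 = (k : ℂ)⁻¹ • G.adjMatrix ℂ := by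
  have hpos : ∀ x, 0 < G.degree x := fun x => by rw [hG.degree_eq]; exact hk
  rw [compression, pow_one, timeEvolution_mul_conjTranspose G hpos]
  ext x y
  have hs : ((Real.sqrt (k : ℝ) : ℝ) : ℂ) * ((Real.sqrt (k : ℝ) : ℝ) : ℂ) = k := by
    rw [← Complex.ofReal_mul, Real.mul_self_sqrt (Nat.cast_nonneg _)]
    simp
  rw [Matrix.mul_apply]
  simp only [shift_mul_apply, boundary_conjTranspose_apply, boundary_apply,
    hG.degree_eq, Matrix.smul_apply, SimpleGraph.adjMatrix_apply, SimpleGraph.Dart.symm,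
    Prod.snd_swap, smul_eq_mul, mul_ite, mul_one, mul_zero, ite_mul, zero_mul, div_mul_div_comm, hs]
  split_ifs with hxy
  · rw [Finset.sum_eq_single (⟨(y, x), hxy.symm⟩ : G.Dart)]
    · simp
    · intro a _ ha
      split_ifs with h1 h2 <;> try rfl
      exact (ha (SimpleGraph.Dart.ext _ _ (Prod.ext h1.symm h2.symm))).elim
    · simp
  · refine Finset.sum_eq_zero fun a _ => ?_
    split_ifs with h1 h2 <;> try rfl
    exact (hxy (by rw [h1, h2]; exact a.adj.symm)).elim

theorem compression_mulVec (h : ∀ x, 0 < G.degree x) {u : V → ℂ} {c : ℂ}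
    (hu : compression G 1 *ᵥ u = c • u) (n : ℕ) :
    compression G n *ᵥ u = (T ℂ n).eval c • u := by
  induction n using Nat.twoStepInduction with
  | zero => simp [compression_zero G h]
  | one => simpa using hu
  | more n ih₀ ih₁ =>
    rw [compression_add_two G h, Matrix.sub_mulVec, Matrix.smul_mulVec, ← Matrix.mulVec_mulVec,
      hu, Matrix.mulVec_smul, ih₀, ih₁, show ((n + 2 : ℕ) : ℤ) = n + 2 by push_cast; rfl,
      show ((n + 1 : ℕ) : ℤ) = n + 1 by push_cast; rfl, T_add_two]
    simp only [Polynomial.eval_sub, Polynomial.eval_mul, Polynomial.eval_ofNat, Polynomial.eval_X]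
    module

theorem star_dotProduct_boundary (h : ∀ x, 0 < G.degree x) (f g : V → ℂ) :
    star ((boundary G)ᴴ *ᵥ f) ⬝ᵥ ((boundary G)ᴴ *ᵥ g) = star f ⬝ᵥ g := by
  rw [Matrix.star_mulVec, Matrix.conjTranspose_conjTranspose, ← Matrix.dotProduct_mulVec,
    Matrix.mulVec_mulVec, boundary_mul_conjTranspose G h, Matrix.one_mulVec]

theorem isState_vertexType (h : ∀ x, 0 < G.degree x) (x : V) :
    IsState ((boundary G)ᴴ *ᵥ Pi.single x 1) := by
  have h1 := star_dotProduct_boundary G h (Pi.single x 1) (Pi.single x 1)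
  have h2 := inner_self_eq_norm_sq_to_K (𝕜 := ℂ)
    (WithLp.toLp 2 ((boundary G)ᴴ *ᵥ (Pi.single x 1 : V → ℂ)))
  rw [EuclideanSpace.inner_eq_star_dotProduct, dotProduct_comm, h1] at h2
  have h3 : ‖WithLp.toLp 2 ((boundary G)ᴴ *ᵥ (Pi.single x 1 : V → ℂ))‖ ^ 2 = 1 := by
    simp only [dotProduct_single, Pi.star_apply, Pi.single_eq_same, star_one, mul_one] at h2
    exact Complex.ofReal_injective (by simpa using h2.symm)
  exact (pow_eq_one_iff_of_nonneg (norm_nonneg _) two_ne_zero).1 h3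

theorem AdmitsPST.exists_compression (h : ∀ x, 0 < G.degree x) (hP : AdmitsPST G) :
    ∃ x y : V, x ≠ y ∧ ∃ n : ℕ, 1 ≤ n ∧ ∃ γ : ℂ, γ ≠ 0 ∧
      compression G n *ᵥ Pi.single x 1 = γ • Pi.single y 1 := by
  obtain ⟨Φ, Ψ, ⟨-, x, rfl⟩, ⟨-, y, rfl⟩, hne, n, -, -, -, hn, γ, hγ, hU⟩ := hP
  refine ⟨x, y, fun hxy => hne (by rw [hxy]), n, hn, γ, fun h0 => by simp [h0] at hγ, ?_⟩
  rw [compression, ← Matrix.mulVec_mulVec, ← Matrix.mulVec_mulVec, hU, Matrix.mulVec_smul,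
    Matrix.mulVec_mulVec, boundary_mul_conjTranspose G h, Matrix.one_mulVec]

-- Equality case of Cauchy–Schwarz: `Uⁿ Φ` and `Ψ` are unit vectors with inner product `1`, so the
-- squared norm of their difference is `1 - 1 - 1 + 1 = 0`.
open scoped ComplexOrder in
theorem admitsPST_of_compression (h : ∀ x, 0 < G.degree x) {x y : V} (hxy : x ≠ y) {n : ℕ}
    (hn : 1 ≤ n) (hc : compression G n *ᵥ Pi.single x 1 = Pi.single y 1) : AdmitsPST G := by
  have hne : (boundary G)ᴴ *ᵥ (Pi.single x 1 : V → ℂ) ≠ (boundary G)ᴴ *ᵥ Pi.single y 1 := by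
    intro he
    have := congrArg (boundary G *ᵥ ·) he
    simp only [Matrix.mulVec_mulVec, boundary_mul_conjTranspose G h, Matrix.one_mulVec] at this
    have := congrFun this x
    simp [hxy] at this
  have hx := isState_vertexType G h x
  have hy := isState_vertexType G h y
  refine ⟨_, _, ⟨hx, x, rfl⟩, ⟨hy, y, rfl⟩, hne, n, hx, hy, hne, hn, 1, norm_one, ?_⟩
  rw [one_smul, ← sub_eq_zero, ← dotProduct_star_self_eq_zero]
  set Φ := (boundary G)ᴴ *ᵥ (Pi.single x 1 : V → ℂ) with hΦ
  set Ψ := (boundary G)ᴴ *ᵥ (Pi.single y 1 : V → ℂ) with hΨ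
  have h1 : star (timeEvolution G ^ n *ᵥ Φ) ⬝ᵥ (timeEvolution G ^ n *ᵥ Φ) = 1 := by
    rw [Matrix.star_mulVec, ← Matrix.dotProduct_mulVec, Matrix.mulVec_mulVec,
      timeEvolution_pow_conjTranspose_mul_self G h, Matrix.one_mulVec, hΦ,
      star_dotProduct_boundary G h]
    simp
  have h2 : star Ψ ⬝ᵥ Ψ = 1 := by
    rw [hΨ, star_dotProduct_boundary G h]
    simp
  have hcomp : boundary G *ᵥ (timeEvolution G ^ n *ᵥ Φ) = compression G n *ᵥ Pi.single x 1 := by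
    rw [compression, ← Matrix.mulVec_mulVec, ← Matrix.mulVec_mulVec]
  have h3 : star Ψ ⬝ᵥ (timeEvolution G ^ n *ᵥ Φ) = 1 := by
    rw [hΨ, Matrix.star_mulVec, Matrix.conjTranspose_conjTranspose, ← Matrix.dotProduct_mulVec,
      hcomp, hc]
    simp
  have h4 : star (timeEvolution G ^ n *ᵥ Φ) ⬝ᵥ Ψ = 1 := by
    rw [Matrix.star_dotProduct, h3, star_one]
  rw [star_sub, sub_dotProduct, dotProduct_sub, dotProduct_sub, h1, h2, h3, h4]
  ring

end Walk

/-! ### Cocktail party graphs: structure, spectrum and admissible degrees -/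

section Cocktail

/-- The involution `σ` exhibits `G` as a cocktail party graph: two distinct vertices are adjacent
unless `σ` interchanges them. -/
structure IsCocktailParty {V : Type*} (G : SimpleGraph V) (σ : V → V) : Prop where
  involutive : ∀ v, σ (σ v) = v
  ne : ∀ v, σ v ≠ v
  adj_iff : ∀ v w, G.Adj v w ↔ w ≠ v ∧ w ≠ σ v

theorem IsCocktailParty.of_iso {V W : Type*} {G : SimpleGraph V} {H : SimpleGraph W} {σ : W → W}
    (hσ : IsCocktailParty H σ) (e : G ≃g H) : IsCocktailParty G (fun v => e.symm (σ (e v))) where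
  involutive v := by simp [hσ.involutive]
  ne v h := hσ.ne (e v) (by simpa using congrArg e h)
  adj_iff v w := by
    rw [← e.map_adj_iff, hσ.adj_iff, e.injective.ne_iff, ← e.injective.ne_iff (y := e.symm _),
      e.apply_symm_apply]

theorem isCocktailParty_completeMultipartiteGraph (m : ℕ) :
    IsCocktailParty (SimpleGraph.completeMultipartiteGraph (fun _ : Fin m => Fin 2))
      (fun v => ⟨v.1, v.2 + 1⟩) where
  involutive := by
    rintro ⟨i, j⟩
    fin_cases j <;> rfl
  ne := by
    rintro ⟨i, j⟩
    fin_cases j <;> simp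
  adj_iff := by
    rintro ⟨i, j⟩ ⟨i', j'⟩
    by_cases h : i = i'
    · subst h
      fin_cases j <;> fin_cases j' <;> simp
    · simp [h, Ne.symm h]

/-- Non-adjacency is an equivalence relation with classes `{v, σ v}`; counting vertices gives `m`
classes. -/
theorem IsCocktailParty.nonempty_iso {V : Type*} [Fintype V] {G : SimpleGraph V} {σ : V → V}
    (hσ : IsCocktailParty G σ) {m : ℕ} (hm : Fintype.card V = 2 * m) :
    Nonempty (G ≃g SimpleGraph.completeMultipartiteGraph (fun _ : Fin m => Fin 2)) := by
  classical
  have hnot : ∀ v w, ¬ G.Adj v w ↔ w = v ∨ w = σ v := fun v w => by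
    rw [hσ.adj_iff]; tauto
  have hG : G.IsCompleteMultipartite := ⟨fun a b c hab hbc => by
    rw [hnot] at *
    rcases hab with rfl | rfl <;> rcases hbc with rfl | rfl <;> simp [hσ.involutive]⟩
  have hcard : ∀ c : Quotient hG.setoid,
      Nonempty ({x // hG.setoid.r c.out x} ≃ Fin 2) := fun c => by
    rw [← Fintype.card_eq, Fintype.card_fin, Fintype.card_subtype]
    have : (Finset.univ.filter fun x => hG.setoid.r c.out x) = {c.out, σ c.out} := by
      ext x
      simpa using (show hG.setoid.r c.out x ↔ _ from hnot c.out x)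
    rw [this, Finset.card_pair (hσ.ne _).symm]
  have f := fun c => Classical.choice (hcard c)
  have hQ : Nonempty (Quotient hG.setoid ≃ Fin m) := by
    rw [← Fintype.card_eq, Fintype.card_fin]
    have := Fintype.card_congr (hG.iso.toEquiv.trans (Equiv.sigmaCongrRight f))
    simp at this
    omega
  obtain ⟨q⟩ := hQ
  refine ⟨hG.iso.trans ⟨Equiv.sigmaCongr q f, ?_⟩⟩
  rintro ⟨c, x⟩ ⟨c', x'⟩
  simp [Equiv.sigmaCongr]

theorem nonempty_iso_completeBipartiteGraph :
    Nonempty (SimpleGraph.completeMultipartiteGraph (fun _ : Fin 2 => Fin 2) ≃g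
      completeBipartiteGraph (Fin 2) (Fin 2)) := by
  refine ⟨⟨(Equiv.sigmaEquivProd _ _).trans
    ((finTwoEquiv.prodCongr (Equiv.refl _)).trans (Equiv.boolProdEquivSum _)), ?_⟩⟩
  rintro ⟨i, j⟩ ⟨i', j'⟩
  fin_cases i <;> fin_cases i' <;> simp [finTwoEquiv]

variable {V : Type*} [Fintype V] [DecidableEq V] {G : SimpleGraph V} [DecidableRel G.Adj]
  {σ : V → V}

theorem IsCocktailParty.degree_add_two (hσ : IsCocktailParty G σ) (v : V) :
    G.degree v + 2 = Fintype.card V := by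
  have : G.neighborFinset v = Finset.univ \ {v, σ v} := by
    ext w
    simp [hσ.adj_iff]
  rw [← G.card_neighborFinset_eq_degree, this, Finset.card_sdiff_of_subset (Finset.subset_univ _),
    Finset.card_pair (hσ.ne v).symm, Finset.card_univ]
  have := Finset.card_le_univ {v, σ v}
  rw [Finset.card_pair (hσ.ne v).symm] at this
  omega

theorem IsCocktailParty.adjMatrix_mulVec (hσ : IsCocktailParty G σ) (f : V → ℂ) (v : V) :
    (G.adjMatrix ℂ *ᵥ f) v = ∑ w, f w - f v - f (σ v) := by
  have : G.neighborFinset v = Finset.univ \ {v, σ v} := by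
    ext w
    simp [hσ.adj_iff]
  rw [SimpleGraph.adjMatrix_mulVec_apply, this, eq_sub_iff_add_eq, eq_sub_iff_add_eq, add_assoc,
    add_comm (f (σ v)), ← Finset.sum_pair (hσ.ne v).symm,
    Finset.sum_sdiff (Finset.subset_univ _)]

theorem IsCocktailParty.compression_one_mulVec (hσ : IsCocktailParty G σ) {k : ℕ}
    (hk : 0 < k) (hV : Fintype.card V = k + 2) (f : V → ℂ) (v : V) :
    (compression G 1 *ᵥ f) v = (k : ℂ)⁻¹ * (∑ w, f w - f v - f (σ v)) := by
  have hG : G.IsRegularOfDegree k := fun v => by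
    have := hσ.degree_add_two v
    omega
  rw [compression_one G hG hk, Matrix.smul_mulVec, Pi.smul_apply, hσ.adjMatrix_mulVec, smul_eq_mul]

/-- Splits `e_x` into eigenvectors of `A / k`: a constant vector (eigenvalue `1`), a
`σ`-antisymmetric one (`0`), and a `σ`-symmetric one of sum zero (`-2/k`). -/
theorem IsCocktailParty.compression_mulVec_single (hσ : IsCocktailParty G σ) {k : ℕ}
    (hk : 0 < k) (hV : Fintype.card V = k + 2) (n : ℕ) (x : V) :
    compression G n *ᵥ Pi.single x 1 =
      ((k : ℂ) + 2)⁻¹ • (1 : V → ℂ)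
      + ((T ℂ n).eval 0 / 2) • (Pi.single x 1 - Pi.single (σ x) 1)
      + ((T ℂ n).eval (-2 / (k : ℂ)) / 2) •
        (Pi.single x 1 + Pi.single (σ x) 1 - (2 / ((k : ℂ) + 2)) • 1) := by
  have hpos : ∀ v, 0 < G.degree v := fun v => by
    have := hσ.degree_add_two v
    omega
  have hk0 : (k : ℂ) ≠ 0 := by exact_mod_cast hk.ne'
  have hk2 : (k : ℂ) + 2 ≠ 0 := by exact_mod_cast (by omega : k + 2 ≠ 0)
  have hswap : ∀ v w (a : ℂ), (Pi.single v a : V → ℂ) (σ w) = (Pi.single (σ v) a : V → ℂ) w := by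
    intro v w a
    have : σ w = v ↔ w = σ v :=
      ⟨fun h => by rw [← h, hσ.involutive], fun h => by rw [h, hσ.involutive]⟩
    simp [Pi.single_apply, this]
  have h1 : compression G n *ᵥ (1 : V → ℂ) = (T ℂ n).eval 1 • (1 : V → ℂ) := by
    refine compression_mulVec G hpos ?_ n
    ext v
    rw [hσ.compression_one_mulVec hk hV]
    simp [hV]
    field_simp
    ring
  have h2 : compression G n *ᵥ (Pi.single x 1 - Pi.single (σ x) 1) =
      (T ℂ n).eval 0 • (Pi.single x 1 - Pi.single (σ x) 1 : V → ℂ) := by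
    refine compression_mulVec G hpos ?_ n
    ext v
    rw [hσ.compression_one_mulVec hk hV]
    simp [hswap, hσ.involutive]
  have h3 : compression G n *ᵥ (Pi.single x 1 + Pi.single (σ x) 1 - (2 / ((k : ℂ) + 2)) • 1) =
      (T ℂ n).eval (-2 / (k : ℂ)) •
        (Pi.single x 1 + Pi.single (σ x) 1 - (2 / ((k : ℂ) + 2)) • 1 : V → ℂ) := by
    refine compression_mulVec G hpos ?_ n
    ext v
    rw [hσ.compression_one_mulVec hk hV]
    simp [hswap, hσ.involutive, Finset.sum_add_distrib, hV]
    field_simp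
    ring
  have hx : (Pi.single x 1 : V → ℂ) = ((k : ℂ) + 2)⁻¹ • (1 : V → ℂ)
      + (1 / 2 : ℂ) • (Pi.single x 1 - Pi.single (σ x) 1)
      + (1 / 2 : ℂ) • (Pi.single x 1 + Pi.single (σ x) 1 - (2 / ((k : ℂ) + 2)) • 1) := by
    module
  conv_lhs => rw [hx]
  rw [Matrix.mulVec_add, Matrix.mulVec_add, Matrix.mulVec_smul, Matrix.mulVec_smul,
    Matrix.mulVec_smul, h1, h2, h3, T_eval_one]
  module

theorem IsCocktailParty.admitsPST (hσ : IsCocktailParty G σ) [Nonempty V] {k n : ℕ}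
    (hk : 0 < k) (hV : Fintype.card V = k + 2) (hn : 1 ≤ n) (h0 : (T ℂ n).eval 0 = -1)
    (h1 : (T ℂ n).eval (-2 / (k : ℂ)) = 1) : AdmitsPST G := by
  obtain ⟨x⟩ := ‹Nonempty V›
  refine admitsPST_of_compression G (fun v => ?_) (hσ.ne x).symm hn ?_
  · have := hσ.degree_add_two v
    omega
  · rw [hσ.compression_mulVec_single hk hV, h0, h1]
    module

theorem IsCocktailParty.eval_T_eq_one (hσ : IsCocktailParty G σ) {k n : ℕ}
    (hk : 0 < k) (hV : Fintype.card V = k + 2) {x y : V} (hy : y = σ x) {γ : ℂ}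
    (h : compression G n *ᵥ Pi.single x 1 = γ • Pi.single y 1) :
    (T ℂ n).eval (-2 / (k : ℂ)) = 1 := by
  subst hy
  have hk2 : (k : ℂ) + 2 ≠ 0 := by exact_mod_cast (by omega : k + 2 ≠ 0)
  obtain ⟨w, hw⟩ : ∃ w, G.Adj x w := by
    rw [← G.degree_pos_iff_exists_adj]
    have := hσ.degree_add_two x
    omega
  obtain ⟨h1, h2⟩ := (hσ.adj_iff x w).1 hw
  -- At a neighbour `w` of `x`, which is neither `x` nor `σ x`, the equation reads `(1 - Tₙ(-2/k)) /
  -- (k + 2) = 0`.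
  have := congrFun h w
  rw [hσ.compression_mulVec_single hk hV] at this
  simp [h1, h2] at this
  field_simp at this
  rw [neg_div]
  linear_combination -this

theorem eq_two_or_four_of_eval_T_eq_one {k n : ℕ} (hk : 2 ≤ k) (hn : 1 ≤ n)
    (h : (T ℂ n).eval (-2 / (k : ℂ)) = 1) : k = 2 ∨ k = 4 := by
  have hk' : (2 : ℝ) ≤ k := by exact_mod_cast hk
  have hcos : Real.cos (Real.arccos (-2 / k)) = -2 / k := by
    apply Real.cos_arccos
    · rw [le_div_iff₀ (by linarith)]; linarith
    · rw [div_le_iff₀ (by linarith)]; linarith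
  have hT : Real.cos ((n : ℤ) * Real.arccos (-2 / k)) = 1 := by
    rw [← T_real_cos, hcos]
    apply Complex.ofReal_injective
    rw [complex_ofReal_eval_T]
    push_cast
    exact_mod_cast h
  obtain ⟨j, hj⟩ := (Real.cos_eq_one_iff _).1 hT
  have hn' : (n : ℝ) ≠ 0 := by exact_mod_cast (by omega : n ≠ 0)
  have := niven (θ := Real.arccos (-2 / k)) ⟨2 * j / n, by
    push_cast at hj ⊢
    rw [div_mul_eq_mul_div, eq_div_iff hn']
    linarith⟩ ⟨-2 / k, by rw [hcos]; push_cast; rfl⟩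
  rw [hcos] at this
  simp only [Set.mem_insert_iff, Set.mem_singleton_iff] at this
  have hk0 : (k : ℝ) ≠ 0 := by linarith
  field_simp at this
  -- Niven's values `-1` and `-1/2` give `k = 2` and `k = 4`; the other three are excluded because
  -- `-2/k` is negative.
  rcases this with h | h | h | h | h
  · left; exact_mod_cast (by linarith : (k : ℝ) = 2)
  · right; exact_mod_cast (by linarith : (k : ℝ) = 4)
  all_goals linarith

end Cocktail

/-! ### Strongly regular graphs: reduction to cocktail party graphs -/

section StronglyRegular
variable {V : Type*} [Fintype V] [DecidableEq V] {G : SimpleGraph V} [DecidableRel G.Adj]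

/-- Expand `J A = k J` with `J = 1 + A + Ā` and substitute the strongly regular formula for `A²`. -/
theorem _root_.SimpleGraph.IsSRGWith.compl_adjMatrix_mul_adjMatrix {n k l m : ℕ}
    (hG : G.IsSRGWith n k l m) :
    Gᶜ.adjMatrix ℂ * G.adjMatrix ℂ =
      ((k : ℂ) - l - 1) • G.adjMatrix ℂ + ((k : ℂ) - m) • Gᶜ.adjMatrix ℂ := by
  have hJ : 1 + G.adjMatrix ℂ + Gᶜ.adjMatrix ℂ = Matrix.of fun _ _ => 1 := by
    ext x y
    by_cases hxy : x = y <;> by_cases hadj : G.Adj x y <;>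
      simp_all [SimpleGraph.adjMatrix_apply]
  have hsq := hG.matrix_eq (α := ℂ)
  have hJA : (Matrix.of fun _ _ => (1 : ℂ) : Matrix V V ℂ) * G.adjMatrix ℂ =
      (k : ℂ) • Matrix.of fun _ _ => (1 : ℂ) := by
    ext x y
    rw [SimpleGraph.mul_adjMatrix_apply]
    simp [hG.regular.degree_eq]
  rw [← hJ, Matrix.add_mul, Matrix.add_mul, Matrix.one_mul, ← pow_two, hsq] at hJA
  simp only [← Nat.cast_smul_eq_nsmul ℂ] at hJA
  rw [← eq_sub_iff_add_eq'] at hJA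
  rw [hJA]
  module

theorem _root_.SimpleGraph.IsSRGWith.exists_compression_eq {n k l m : ℕ}
    (hG : G.IsSRGWith n k l m) (hk : 0 < k) (j : ℕ) :
    ∃ a b c : ℂ, compression G j = a • 1 + b • G.adjMatrix ℂ + c • Gᶜ.adjMatrix ℂ := by
  have hpos : ∀ x, 0 < G.degree x := fun x => by rw [hG.regular.degree_eq]; exact hk
  induction j using Nat.twoStepInduction with
  | zero => exact ⟨1, 0, 0, by simp [compression_zero G hpos]⟩
  | one => exact ⟨0, (k : ℂ)⁻¹, 0, by simp [compression_one G hG.regular hk]⟩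
  | more j ih₀ ih₁ =>
    obtain ⟨a₀, b₀, c₀, h₀⟩ := ih₀
    obtain ⟨a, b, c, h₁⟩ := ih₁
    have hsq := hG.matrix_eq (α := ℂ)
    simp only [← Nat.cast_smul_eq_nsmul ℂ, pow_two] at hsq
    refine ⟨2 * (k : ℂ)⁻¹ * (b * k) - a₀,
      2 * (k : ℂ)⁻¹ * (a + b * l + c * (k - l - 1)) - b₀,
      2 * (k : ℂ)⁻¹ * (b * m + c * (k - m)) - c₀, ?_⟩
    rw [compression_add_two G hpos, h₀, h₁, compression_one G hG.regular hk, Matrix.mul_smul,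
      Matrix.add_mul, Matrix.add_mul, Matrix.smul_mul, Matrix.smul_mul, Matrix.smul_mul,
      Matrix.one_mul, hsq, hG.compl_adjMatrix_mul_adjMatrix]
    module

theorem exists_isCocktailParty_of_compression (hconn : G.Connected) (htop : G ≠ ⊤)
    {n k l m : ℕ} (hG : G.IsSRGWith n k l m) (hk : 0 < k) {x y : V} (hxy : x ≠ y) {j : ℕ}
    {γ : ℂ} (hγ : γ ≠ 0) (h : compression G j *ᵥ Pi.single x 1 = γ • Pi.single y 1) :
    ∃ σ : V → V, IsCocktailParty G σ ∧ y = σ x := by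
  obtain ⟨a, b, c, hT⟩ := hG.exists_compression_eq hk j
  have hent : ∀ z, z ≠ x → (if G.Adj z x then b else c) = if z = y then γ else 0 := by
    intro z hz
    have := congrFun h z
    rw [hT, Matrix.mulVec_single_one] at this
    by_cases hzx : G.Adj z x <;> simpa [hz, hzx, Matrix.one_apply, Pi.single_apply] using this
  have hy := hent y hxy.symm
  by_cases hadj : G.Adj y x
  · exfalso
    simp only [hadj, if_true] at hy
    have hx : G.neighborFinset x = {y} := by
      ext z
      rw [SimpleGraph.mem_neighborFinset, Finset.mem_singleton]
      refine ⟨fun hz => ?_, fun hz => hz ▸ hadj.symm⟩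
      have := hent z hz.ne'
      rw [if_pos hz.symm, hy] at this
      by_contra hzy
      rw [if_neg hzy] at this
      exact hγ this
    have hk1 : k = 1 := by
      rw [← hG.regular.degree_eq x, ← G.card_neighborFinset_eq_degree, hx, Finset.card_singleton]
    have hyx : G.neighborFinset y = {x} := by
      obtain ⟨w, hw⟩ := Finset.card_eq_one.1
        ((G.card_neighborFinset_eq_degree y).trans ((hG.regular.degree_eq y).trans hk1))
      have : x ∈ G.neighborFinset y := by simpa using hadj
      rw [hw, Finset.mem_singleton] at this
      rw [hw, this]
    have hall : ∀ z, z = x ∨ z = y := by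
      intro z
      have := (SimpleGraph.reachable_iff_reflTransGen x z).1 (hconn.preconnected x z)
      induction this with
      | refl => exact Or.inl rfl
      | tail _ hvw ih =>
        rw [← SimpleGraph.mem_neighborFinset] at hvw
        rcases ih with rfl | rfl
        · rw [hx] at hvw; exact Or.inr (Finset.mem_singleton.1 hvw)
        · rw [hyx] at hvw; exact Or.inl (Finset.mem_singleton.1 hvw)
    refine htop ?_
    ext u v
    rw [SimpleGraph.top_adj]
    refine ⟨fun huv => huv.ne, fun huv => ?_⟩
    rcases hall u with rfl | rfl <;> rcases hall v with rfl | rfl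
    · exact (huv rfl).elim
    · exact hadj.symm
    · exact hadj
    · exact (huv rfl).elim
  · simp only [hadj, if_false, if_true] at hy
    have hx : Gᶜ.neighborFinset x = {y} := by
      ext z
      rw [SimpleGraph.mem_neighborFinset, Finset.mem_singleton, SimpleGraph.compl_adj]
      refine ⟨fun hz => ?_, fun hz => ?_⟩
      · have := hent z hz.1.symm
        rw [if_neg (fun h => hz.2 h.symm), hy] at this
        by_contra hzy
        rw [if_neg hzy] at this
        exact hγ this
      · subst hz
        exact ⟨hxy, fun h => hadj h.symm⟩
    -- Regularity spreads the single non-neighbour of `x` to every vertex, so the complement is a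
    -- perfect matching and `σ` sends each vertex to its partner.
    have hdeg : ∀ v, Gᶜ.degree v = 1 := by
      intro v
      rw [SimpleGraph.degree_compl, hG.regular.degree_eq, ← hG.regular.degree_eq x,
        ← SimpleGraph.degree_compl, ← Gᶜ.card_neighborFinset_eq_degree, hx, Finset.card_singleton]
    choose σ hσ using fun v =>
      (Finset.card_eq_one.1 ((Gᶜ.card_neighborFinset_eq_degree v).trans (hdeg v)))
    have hadj' : ∀ v w, Gᶜ.Adj v w ↔ w = σ v := fun v w => by
      rw [← SimpleGraph.mem_neighborFinset, hσ, Finset.mem_singleton]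
    refine ⟨σ, ⟨fun v => ?_, fun v hv => ?_, fun v w => ?_⟩, ?_⟩
    · exact ((hadj' _ _).1 ((hadj' v _).2 rfl).symm).symm
    · exact Gᶜ.irrefl ((hadj' v v).2 hv.symm)
    · rw [ne_eq w (σ v), ← hadj', SimpleGraph.compl_adj]
      constructor
      · exact fun h => ⟨h.ne', fun h' => h'.2 h⟩
      · rintro ⟨h1, h2⟩
        by_contra h3
        exact h2 ⟨h1.symm, h3⟩
    · rw [← hadj', ← SimpleGraph.mem_neighborFinset, hx]
      exact Finset.mem_singleton_self y

end StronglyRegular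

theorem eval_T_six (c : ℂ) : (T ℂ 6).eval c = 32 * c ^ 6 - 48 * c ^ 4 + 18 * c ^ 2 - 1 := by
  have h3 := T_add_two ℂ 1
  have h4 := T_add_two ℂ 2
  have h5 := T_add_two ℂ 3
  have h6 := T_add_two ℂ 4
  norm_num at h3 h4 h5 h6
  rw [h6, h5, h4, h3, T_two]
  simp
  ring
end GroverWalk

/-! ### The classification -/

open GroverWalk in
theorem mainTheorem1 {V : Type*} [Fintype V] [DecidableEq V] (G : SimpleGraph V)
    [DecidableRel G.Adj] (hconn : G.Connected) (hsrg : GroverWalk.IsStronglyRegular G) :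
    GroverWalk.AdmitsPST G ↔
      (Nonempty (G ≃g completeBipartiteGraph (Fin 2) (Fin 2)) ∨
        Nonempty (G ≃g SimpleGraph.completeMultipartiteGraph (fun _ : Fin 3 => Fin 2))) := by
  obtain ⟨htop, hbot, n, k, l, m, hG⟩ := hsrg
  have := hconn.nonempty
  constructor
  · intro hP
    have hk : 0 < k := by
      obtain ⟨u, v, huv⟩ := SimpleGraph.ne_bot_iff_exists_adj.1 hbot
      rw [← hG.regular.degree_eq u, G.degree_pos_iff_exists_adj]
      exact ⟨v, huv⟩
    obtain ⟨x, y, hxy, j, hj, γ, hγ, hc⟩ :=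
      hP.exists_compression G (fun x => by rw [hG.regular.degree_eq]; exact hk)
    obtain ⟨σ, hσ, hy⟩ := exists_isCocktailParty_of_compression hconn htop hG hk hxy hγ hc
    have hV : Fintype.card V = k + 2 := by
      rw [← hσ.degree_add_two x, hG.regular.degree_eq]
    -- A neighbour `w` of `x` is also adjacent to `σ x`, so it has degree at least `2`.
    have hk2 : 2 ≤ k := by
      obtain ⟨w, hw⟩ := (G.degree_pos_iff_exists_adj x).1 (by rw [hG.regular.degree_eq]; exact hk)
      have hw' : G.Adj w (σ x) := by
        rw [hσ.adj_iff] at hw ⊢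
        exact ⟨hw.2.symm, fun h => hw.1 (by rw [← hσ.involutive w, ← h, hσ.involutive])⟩
      rw [← hG.regular.degree_eq w, ← G.card_neighborFinset_eq_degree,
        ← Finset.card_pair (hσ.ne x)]
      refine Finset.card_le_card ?_
      simp [Finset.insert_subset_iff, hw', hw.symm]
    rcases eq_two_or_four_of_eval_T_eq_one hk2 hj (hσ.eval_T_eq_one hk hV hy hc) with rfl | rfl
    · obtain ⟨e⟩ := hσ.nonempty_iso (m := 2) hV
      obtain ⟨f⟩ := nonempty_iso_completeBipartiteGraph
      exact Or.inl ⟨e.trans f⟩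
    · exact Or.inr (hσ.nonempty_iso (m := 3) hV)
  · rintro (⟨⟨e⟩⟩ | ⟨⟨e⟩⟩)
    · obtain ⟨f⟩ := nonempty_iso_completeBipartiteGraph
      -- Here `-2/k = -1`, with `T₂(0) = -1` and `T₂(-1) = 1`.
      refine ((isCocktailParty_completeMultipartiteGraph 2).of_iso (e.trans f.symm)).admitsPST
        (k := 2) (n := 2) two_pos ?_ one_le_two ?_ ?_
      · rw [Fintype.card_congr e.toEquiv]; rfl
      · norm_num [T_two]
      · norm_num [T_two]
    -- Here `-2/k = -1/2 = cos (2π/3)`: `Tₙ(-1/2) = 1` needs `3 ∣ n` and `Tₙ(0) = -1` needs `n ≡ 2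
    -- mod 4`, so `6` is the least time.
    · refine ((isCocktailParty_completeMultipartiteGraph 3).of_iso e).admitsPST
        (k := 4) (n := 6) four_pos ?_ (by norm_num) ?_ ?_
      · rw [Fintype.card_congr e.toEquiv]; rfl
      · norm_num [eval_T_six]
      · norm_num [eval_T_six]
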